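/- Let $k$ be an algebraically closed field. For a $k$-variety $X$ (separated, of finite type over $k$) let $K_0(\mathrm{Var}/X)$ be the Grothendieck ring of varieties over $X$, generated by isomorphism classes $[Y\to X]$ with $[Y]=[Z]+[U]$ for $Z\subseteq Y$ closed with open complement $U$, and with product the fibre product over $X$; write $K_0(\mathrm{Var}_k)=K_0(\mathrm{Var}/\operatorname{Spec}k)$, with unit $\star=[\operatorname{Spec} k]$. For a morphism $f\colon X\to X'$ of varieties let $f^*\colon K_0(\mathrm{Var}/X')\to K_0(\mathrm{Var}/X)$ be base change and $f_!\colon K_0(\mathrm{Var}/X)\to K_0(\mathrm{Var}/X')$ be composition with $f$. Let $G$ be an algebraic group over $k$ (a reduced variety with a group structure), let $g,s\ge 0$, let $\lambda_1,\dots,\lambda_s\subseteq G$ be locally closed subvarieties that are closed under conjugation, and let $\epsilon_1,\dots,\epsilon_s\in\{1,-1\}$. Let $\Sigma_g$ be the closed oriented surface of genus $g$ and let $Q$ be the parabolic structure on it given by $s$ marked points with data $\lambda_1,\dots,\lambda_s$, each marked point with an orientation of a small disc around it, where $\epsilon_j=1$ if the orientation at the $j$-th point agrees with that of $\Sigma_g$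 and $\epsilon_j=-1$ otherwise. In terms of the standard presentation $$\Big\langle \alpha_1,\beta_1,\dots,\alpha_g,\beta_g,\gamma_1,\dots,\gamma_s \ \Big|\ \prod_{i=1}^g[\alpha_i,\beta_i]\prod_{j=1}^s\gamma_j=1\Big\rangle$$ of the fundamental group of $\Sigma_g$ without the marked points, with meridians $\gamma_j^{\epsilon_j}$, the variety $\mathfrak X_G(\Sigma_g,Q)$ of representations $\rho$ with $\rho(\gamma_j^{\epsilon_j})\in\lambda_j$ is $$\mathfrak X_G(\Sigma_g,Q)=\Big\{(A_1,B_1,\dots,A_g,B_g,C_1,\dots,C_s)\in G^{2g+s}\ \Big|\ \prod_{i=1}^g[A_i,B_i]\prod_{j=1}^sC_j=1,\ C_j^{\epsilon_j}\in\lambda_j\Big\}.$$ Let $i\colon 1\hookrightarrow G$ be the inclusion of the unit, and put - $Z(D)=i_!\colon K_0(\mathrm{Var}_k)\to K_0(\mathrm{Var}/G)$ and $Z(D^\dagger)=i^*\colon K_0(\mathrm{Var}/G)\to K_0(\mathrm{Var}_k)$; - $Z(L)=q_!\,p^*$ on $K_0(\mathrm{Var}/G)$, where $p,q\colon G^4\to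 G$ are $p(x,a,b,h)=x$ and $q(x,a,b,h)=h\,x\,[a,b]\,h^{-1}$; - $Z(L_{\lambda_j})=t_!\,r^*$ on $K_0(\mathrm{Var}/G)$, where $r,t\colon G^2\times\lambda_j\to G$ are $r(x,h,\xi)=x$ and $t(x,h,\xi)=h\,x\,\xi^{\epsilon_j}h^{-1}$. Then, in $K_0(\mathrm{Var}_k)$, $$[G]^{g+s}\cdot[\mathfrak X_G(\Sigma_g,Q)]=Z(D^\dagger)\circ Z(L_{\lambda_s})\circ\cdots\circ Z(L_{\lambda_1})\circ Z(L)^g\circ Z(D)(\star),$$ and hence, in the localization $K_0(\mathrm{Var}_k)\big[[G]^{-1}\big]$, $$[\mathfrak X_G(\Sigma_g,Q)]=\frac{1}{[G]^{g+s}}\,Z(D^\dagger)\circ Z(L_{\lambda_s})\circ\cdots\circ Z(L_{\lambda_1})\circ Z(L)^g\circ Z(D)(\star).$$ -/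

import Mathlib

open CategoryTheory Limits MonoidalCategory CartesianMonoidalCategory AlgebraicGeometry
open scoped MonObj

universe u

noncomputable section

namespace RepTQFT

/-! ### Varieties over a base and their Grothendieck rings -/

/-- Separated morphisms of finite type: the structure morphisms of varieties over a base. -/
def varMor : MorphismProperty Scheme.{u} := fun _ _ f =>
  IsSeparated f ∧ LocallyOfFiniteType f ∧ QuasiCompact f

instance : (varMor.{u}).IsStableUnderBaseChange where
  of_isPullback sq h :=
    ⟨MorphismProperty.of_isPullback (P := @IsSeparated) sq h.1,
      MorphismProperty.of_isPullback (P := @LocallyOfFiniteType) sq h.2.1,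
      MorphismProperty.of_isPullback (P := @QuasiCompact) sq h.2.2⟩

instance : (varMor.{u}).IsMultiplicative where
  id_mem _ := ⟨inferInstance, inferInstance, inferInstance⟩
  comp_mem f g := by
    rintro ⟨_, _, _⟩ ⟨_, _, _⟩
    exact ⟨inferInstance, inferInstance, inferInstance⟩

lemma varMor_of_comp {X Y Z : Scheme.{u}} (f : X ⟶ Y) (g : Y ⟶ Z)
    (hfg : varMor (f ≫ g)) (hg : varMor g) : varMor f := by
  obtain ⟨_, _, _⟩ := hfg
  obtain ⟨_, _, _⟩ := hg
  exact ⟨IsSeparated.of_comp f g, locallyOfFiniteType_of_comp f g, QuasiCompact.of_comp f g⟩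

/-- Varieties over `S`: separated `S`-schemes of finite type. They need not be reduced; this does
not change the Grothendieck ring, where a scheme and its reduction have the same class. -/
abbrev VarOver (S : Scheme.{u}) : Type (u + 1) := {Y : Over S // varMor Y.hom}

/-- Being isomorphic over `S`. -/
instance isoSetoid (S : Scheme.{u}) : Setoid (VarOver S) where
  r Y Y' := Nonempty (Y.1 ≅ Y'.1)
  iseqv := ⟨fun _ => ⟨Iso.refl _⟩, fun ⟨e⟩ => ⟨e.symm⟩, fun ⟨e⟩ ⟨e'⟩ => ⟨e.trans e'⟩⟩

/-- Isomorphism classes of varieties over `S`. -/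
def IsoClass (S : Scheme.{u}) : Type (u + 1) := Quotient (isoSetoid S)

/-- The fibre product over `S`. -/
def VarOver.prod {S : Scheme.{u}} (Y Z : VarOver S) : VarOver S :=
  ⟨Y.1 ⊗ Z.1, by
    rw [Over.tensorObj_hom]
    exact varMor.comp_mem _ _ (varMor.pullback_fst _ _ Z.2) Y.2⟩

/-- `S` as a variety over itself. -/
def VarOver.unit (S : Scheme.{u}) : VarOver S := ⟨𝟙_ (Over S), varMor.id_mem S⟩

/-- Isomorphism classes form a commutative monoid under fibre product over `S`. -/
instance (S : Scheme.{u}) : CommMonoid (IsoClass S) where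
  mul := Quotient.map₂ VarOver.prod fun _ _ ⟨e⟩ _ _ ⟨e'⟩ => ⟨e ⊗ᵢ e'⟩
  one := Quotient.mk _ (VarOver.unit S)
  mul_assoc := by
    rintro ⟨a⟩ ⟨b⟩ ⟨c⟩
    exact Quotient.sound ⟨α_ a.1 b.1 c.1⟩
  one_mul := by
    rintro ⟨a⟩
    exact Quotient.sound ⟨λ_ a.1⟩
  mul_one := by
    rintro ⟨a⟩
    exact Quotient.sound ⟨ρ_ a.1⟩
  mul_comm := by
    rintro ⟨a⟩ ⟨b⟩
    exact Quotient.sound ⟨β_ a.1 b.1⟩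

/-- The generator attached to a variety over `S`. -/
def gen {S : Scheme.{u}} (Y : VarOver S) : FreeAbelianGroup (IsoClass S) :=
  FreeAbelianGroup.of (Quotient.mk _ Y)

lemma gen_mul {S : Scheme.{u}} (Y Z : VarOver S) : gen Y * gen Z = gen (Y.prod Z) :=
  FreeAbelianGroup.of_mul_of _ _

lemma gen_eq_of_iso {S : Scheme.{u}} {Y Z : VarOver S} (e : Y.1 ≅ Z.1) : gen Y = gen Z :=
  congrArg FreeAbelianGroup.of (Quotient.sound ⟨e⟩)

/-- `Y` is the disjoint union of the closed subvariety `Z` and the open subvariety `U`. -/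
structure Decomposition {S : Scheme.{u}} (Y Z U : VarOver S) where
  i : Z.1 ⟶ Y.1
  j : U.1 ⟶ Y.1
  closed : IsClosedImmersion i.left
  isOpen : IsOpenImmersion j.left
  compl : Set.range i.left = (Set.range j.left)ᶜ

/-- The cut-and-paste relations `[Y] = [Z] + [U]`. -/
def scissor (S : Scheme.{u}) : Set (FreeAbelianGroup (IsoClass S)) :=
  {x | ∃ Y Z U : VarOver S, Nonempty (Decomposition Y Z U) ∧ x = gen Y - gen Z - gen U}

/-- The Grothendieck ring of varieties over `S`, with product the fibre product over `S`. -/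
def K0 (S : Scheme.{u}) : Type (u + 1) :=
  FreeAbelianGroup (IsoClass S) ⧸ Ideal.span (scissor S)

instance (S : Scheme.{u}) : CommRing (K0 S) :=
  inferInstanceAs (CommRing (FreeAbelianGroup (IsoClass S) ⧸ Ideal.span (scissor S)))

/-- The quotient map onto the Grothendieck ring. -/
def K0.mk (S : Scheme.{u}) : FreeAbelianGroup (IsoClass S) →+* K0 S :=
  Ideal.Quotient.mk (Ideal.span (scissor S))

/-- The class `[Y] = [Y → S]`. -/
def K0.cls {S : Scheme.{u}} (Y : Over S) (hY : varMor Y.hom) : K0 S := K0.mk S (gen ⟨Y, hY⟩)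

/-! ### Pullback -/

/-- Base change of a variety over `T` along `h : S ⟶ T`. -/
def VarOver.pull {S T : Scheme.{u}} (h : S ⟶ T) (Y : VarOver T) : VarOver S :=
  ⟨(Over.pullback h).obj Y.1, varMor.pullback_snd _ _ Y.2⟩

/-- Base change on isomorphism classes; it preserves fibre products. -/
def pullClass {S T : Scheme.{u}} (h : S ⟶ T) : IsoClass T →* IsoClass S where
  toFun := Quotient.map (VarOver.pull h) fun _ _ ⟨e⟩ => ⟨(Over.pullback h).mapIso e⟩
  map_one' := Quotient.sound ⟨preservesTerminalIso (Over.pullback h)⟩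
  map_mul' := by
    rintro ⟨a⟩ ⟨b⟩
    exact Quotient.sound ⟨prodComparisonIso (Over.pullback h) a.1 b.1⟩

lemma range_of_isPullback {A B C D : Scheme.{u}} {f : A ⟶ B} {g : A ⟶ C} {i : B ⟶ D} {q : C ⟶ D}
    (h : IsPullback f g i q) : Set.range g = q ⁻¹' Set.range i := by
  have h1 := Scheme.Pullback.range_snd (f := i) (g := q)
  rw [← h1, ← h.isoPullback_hom_snd]
  ext x
  constructor
  · rintro ⟨y, rfl⟩
    exact ⟨h.isoPullback.hom y, by rw [← Scheme.Hom.comp_apply, h.isoPullback_hom_snd]⟩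
  · rintro ⟨y, rfl⟩
    exact ⟨h.isoPullback.inv y, by simp [← Scheme.Hom.comp_apply]⟩

/-- Decompositions are stable under base change. -/
def Decomposition.ofIsPullback {S T : Scheme.{u}} {Y Z U : VarOver T}
    (d : Decomposition Y Z U) {Y' Z' U' : VarOver S} (i' : Z'.1 ⟶ Y'.1) (j' : U'.1 ⟶ Y'.1)
    (p : Z'.1.left ⟶ Z.1.left) (q : Y'.1.left ⟶ Y.1.left) (r : U'.1.left ⟶ U.1.left)
    (hi : IsPullback p i'.left d.i.left q) (hj : IsPullback r j'.left d.j.left q) :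
    Decomposition Y' Z' U' where
  i := i'
  j := j'
  closed := MorphismProperty.of_isPullback (P := @IsClosedImmersion) hi d.closed
  isOpen := MorphismProperty.of_isPullback (P := @IsOpenImmersion) hj d.isOpen
  compl := by
    rw [range_of_isPullback hi, range_of_isPullback hj, d.compl, Set.preimage_compl]

lemma isPullback_pull {S T : Scheme.{u}} (h : S ⟶ T) {Z Y : Over T} (i : Z ⟶ Y) :
    IsPullback (pullback.fst Z.hom h) ((Over.pullback h).map i).left i.left
      (pullback.fst Y.hom h) := by
  refine IsPullback.flip (IsPullback.of_right (h₁₂ := pullback.snd Y.hom h) (h₂₂ := Y.hom)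
    (v₁₃ := h) ?_ ?_ (IsPullback.of_hasPullback Y.hom h).flip)
  · have h1 : ((Over.pullback h).map i).left ≫ pullback.snd Y.hom h = pullback.snd Z.hom h :=
      pullback.lift_snd _ _ _
    rw [h1, Over.w i]
    exact (IsPullback.of_hasPullback Z.hom h).flip
  · exact pullback.lift_fst _ _ _

lemma isPullback_prod {S : Scheme.{u}} (W : Over S) {Z Y : Over S} (i : Z ⟶ Y) :
    IsPullback (snd W Z).left (W ◁ i).left i.left (snd W Y).left := by
  refine IsPullback.flip (IsPullback.of_right (h₁₂ := (fst W Y).left) (h₂₂ := Y.hom)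
    (v₁₃ := W.hom) ?_ ?_ (IsPullback.of_hasPullback W.hom Y.hom))
  · have := IsPullback.of_hasPullback W.hom Z.hom
    simpa using this
  · simp

/-- The ideal of relations is preserved by additive maps which send, for every variety `W`, the
relations multiplied by `[W]` to zero. -/
lemma eq_zero_of_mem_span {S : Scheme.{u}} {A : Type*} [AddCommGroup A]
    (φ : FreeAbelianGroup (IsoClass S) →+ A)
    (hφ : ∀ (Y Z U : VarOver S), Decomposition Y Z U → φ (gen Y - gen Z - gen U) = 0)
    {x : FreeAbelianGroup (IsoClass S)} (hx : x ∈ Ideal.span (scissor S)) : φ x = 0 := by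
  suffices h : ∀ a, φ (a * x) = 0 by simpa using h 1
  induction hx using Submodule.span_induction with
  | mem x hx =>
    obtain ⟨Y, Z, U, ⟨d⟩, rfl⟩ := hx
    intro a
    induction a using FreeAbelianGroup.induction_on with
    | zero => simp
    | of w =>
      obtain ⟨W, rfl⟩ := Quotient.exists_rep w
      have := hφ _ _ _ (d.ofIsPullback (Y' := W.prod Y) (Z' := W.prod Z) (U' := W.prod U)
        (W.1 ◁ d.i) (W.1 ◁ d.j) _ _ _ (isPullback_prod W.1 d.i) (isPullback_prod W.1 d.j))
      rw [← gen_mul, ← gen_mul, ← gen_mul, ← mul_sub, ← mul_sub] at this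
      exact this
    | neg w h => rw [neg_mul, map_neg, h, neg_zero]
    | add a b ha hb => rw [add_mul, map_add, ha, hb, add_zero]
  | zero => simp
  | add x y _ _ hx hy => intro a; rw [mul_add, map_add, hx, hy, add_zero]
  | smul b x _ hx => intro a; rw [smul_eq_mul, ← _root_.mul_assoc]; exact hx _

lemma mk_eq_zero_of_decomposition {S : Scheme.{u}} {Y Z U : VarOver S} (d : Decomposition Y Z U) :
    K0.mk S (gen Y - gen Z - gen U) = 0 :=
  Ideal.Quotient.eq_zero_iff_mem.2 (Ideal.subset_span ⟨Y, Z, U, ⟨d⟩, rfl⟩)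

/-- The ring homomorphism `h^* : K0(Var/T) → K0(Var/S)` given by base change along `h : S ⟶ T`. -/
def pull {S T : Scheme.{u}} (h : S ⟶ T) : K0 T →+* K0 S :=
  Ideal.Quotient.lift (Ideal.span (scissor T))
    (FreeAbelianGroup.liftMonoid
      ((K0.mk S : FreeAbelianGroup (IsoClass S) →* K0 S).comp
        (FreeAbelianGroup.ofMulHom.comp (pullClass h))))
    fun x hx => by
      refine eq_zero_of_mem_span (A := K0 S) (AddMonoidHomClass.toAddMonoidHom
        (FreeAbelianGroup.liftMonoid _)) ?_ hx
      intro Y Z U d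
      have := mk_eq_zero_of_decomposition (d.ofIsPullback (Y' := Y.pull h) (Z' := Z.pull h)
        (U' := U.pull h) _ _ _ _ _ (isPullback_pull h d.i) (isPullback_pull h d.j))
      rw [map_sub, map_sub] at this ⊢
      exact (congrArg₂ (· - ·) (congrArg₂ (· - ·) (FreeAbelianGroup.lift_apply_of _ _)
        (FreeAbelianGroup.lift_apply_of _ _)) (FreeAbelianGroup.lift_apply_of _ _)).trans this

lemma pull_cls {S T : Scheme.{u}} (h : S ⟶ T) (Y : Over T) (hY : varMor Y.hom) :
    pull h (K0.cls Y hY) = K0.cls ((Over.pullback h).obj Y) (varMor.pullback_snd _ _ hY) := by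
  refine (Ideal.Quotient.lift_mk _ _ _).trans ?_
  exact (FreeAbelianGroup.lift_apply_of _ _)

/-! ### Push-forward -/

/-- A variety over `S`, seen over `T` by composing with `h : S ⟶ T`. -/
def VarOver.push {S T : Scheme.{u}} (h : S ⟶ T) (hh : varMor h) (Y : VarOver S) : VarOver T :=
  ⟨(Over.map h).obj Y.1, varMor.comp_mem _ _ Y.2 hh⟩

/-- Composition with `h` on isomorphism classes. -/
def pushClass {S T : Scheme.{u}} (h : S ⟶ T) (hh : varMor h) : IsoClass S → IsoClass T :=
  Quotient.map (VarOver.push h hh) fun _ _ ⟨e⟩ => ⟨(Over.map h).mapIso e⟩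

/-- The additive homomorphism `h_! : K0(Var/S) → K0(Var/T)` given by composition with `h`. -/
def push {S T : Scheme.{u}} (h : S ⟶ T) (hh : varMor h) : K0 S →+ K0 T :=
  QuotientAddGroup.lift (Ideal.span (scissor S)).toAddSubgroup
    (FreeAbelianGroup.lift fun y => K0.mk T (FreeAbelianGroup.of (pushClass h hh y)))
    fun x hx => by
      refine eq_zero_of_mem_span (A := K0 T) _ ?_ hx
      intro Y Z U d
      have := mk_eq_zero_of_decomposition (Y := Y.push h hh) (Z := Z.push h hh)
        (U := U.push h hh) ⟨(Over.map h).map d.i, (Over.map h).map d.j, d.closed, d.isOpen, d.compl⟩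
      rw [map_sub, map_sub] at this ⊢
      exact (congrArg₂ (· - ·) (congrArg₂ (· - ·) (FreeAbelianGroup.lift_apply_of _ _)
        (FreeAbelianGroup.lift_apply_of _ _)) (FreeAbelianGroup.lift_apply_of _ _)).trans this

lemma push_cls {S T : Scheme.{u}} (h : S ⟶ T) (hh : varMor h) (Y : Over S) (hY : varMor Y.hom) :
    push h hh (K0.cls Y hY) = K0.cls ((Over.map h).obj Y) (varMor.comp_mem _ _ hY hh) :=
  FreeAbelianGroup.lift_apply_of _ _

/-! ### Varieties over a fixed base, and push-pull along spans -/

/-- `X` is a variety over `S` (separated and of finite type). -/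
class IsVar {S : Scheme.{u}} (X : Over S) : Prop where
  out : varMor X.hom

/-- Being a variety over `S`, as a property of objects of `Over S`. -/
abbrev isVarProp (S : Scheme.{u}) : ObjectProperty (Over S) := fun X => IsVar X

instance (S : Scheme.{u}) : (isVarProp S).IsClosedUnderIsomorphisms where
  of_iso {X Y} e h := ⟨by
    have : IsIso e.inv.left := inferInstanceAs (IsIso ((Over.forget S).map e.inv))
    rw [← Over.w e.inv]
    exact varMor.comp_mem _ _ (varMor.of_isIso e.inv.left) h.out⟩

instance (S : Scheme.{u}) : IsVar (𝟙_ (Over S)) := ⟨varMor.id_mem S⟩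

instance {S : Scheme.{u}} (X Y : Over S) [hX : IsVar X] [hY : IsVar Y] : IsVar (X ⊗ Y) :=
  ⟨(VarOver.prod ⟨X, hX.out⟩ ⟨Y, hY.out⟩).2⟩

instance {S : Scheme.{u}} {I : Type} [Finite I] (X : I → Over S) [h : ∀ i, IsVar (X i)] :
    IsVar (∏ᶜ X) := by
  have h1 : (isVarProp S).IsClosedUnderLimitsOfShape (Discrete.{0} PEmpty) := ⟨by
    rintro Y ⟨p⟩
    have hY : IsTerminal Y := (IsLimit.equivOfNatIsoOfIso p.diag.uniqueFromEmpty _ _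
      (by exact Cone.ext (Iso.refl _) (by rintro ⟨⟨⟩⟩))).1 p.isLimit
    exact (isVarProp S).prop_of_iso (hY.uniqueUpToIso isTerminalTensorUnit).symm
      (inferInstanceAs (IsVar (𝟙_ (Over S))))⟩
  have h2 : (isVarProp S).IsClosedUnderBinaryProducts := ⟨by
    rintro Y ⟨p⟩
    have h1 : IsVar (p.diag.obj ⟨.left⟩) := p.prop_diag_obj ⟨.left⟩
    have h2 : IsVar (p.diag.obj ⟨.right⟩) := p.prop_diag_obj ⟨.right⟩
    exact (isVarProp S).prop_of_iso (IsLimit.conePointsIsoOfNatIso p.isLimit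
      (tensorProductIsBinaryProduct _ _) (diagramIsoPair p.diag)).symm
      (inferInstanceAs (IsVar (p.diag.obj ⟨.left⟩ ⊗ p.diag.obj ⟨.right⟩)))⟩
  have := ObjectProperty.IsClosedUnderFiniteProducts.mk' (P := isVarProp S)
  exact (isVarProp S).prop_product h

lemma varMor_left {S : Scheme.{u}} {X Y : Over S} [hX : IsVar X] [hY : IsVar Y] (f : X ⟶ Y) :
    varMor f.left :=
  varMor_of_comp f.left Y.hom (by rw [Over.w f]; exact hX.out) hY.out

instance {S : Scheme.{u}} {X Y Z : Over S} [hX : IsVar X] [IsVar Y] [IsVar Z]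
    (f : X ⟶ Z) (g : Y ⟶ Z) : IsVar (pullback f g) := ⟨by
  rw [← Over.w (pullback.fst f g)]
  refine varMor.comp_mem _ _ ?_ hX.out
  exact varMor.of_isPullback ((IsPullback.of_hasPullback f g).map (Over.forget S)).flip
    (varMor_left g)⟩

/-- The class `[X]` in the Grothendieck ring of varieties over `S`. -/
def virtualClass {S : Scheme.{u}} (X : Over S) [hX : IsVar X] : K0 S := K0.cls X hX.out

/-- The homomorphism `g_! ∘ f^*` attached to a span `A ⟵ D ⟶ B` of varieties. -/
def pushPull {S : Scheme.{u}} {A D B : Over S} [IsVar D] [IsVar B] (f : D ⟶ A) (g : D ⟶ B) :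
    K0 A.left →+ K0 B.left :=
  (push g.left (varMor_left g)).comp (pull f.left).toAddMonoidHom

/-! ### Parabolic data and parabolic representation varieties -/

/-- A (locally closed, reduced) subvariety of `G` which is closed under conjugation: for all points
`g` of `G` and `x` of the subvariety, `g x g⁻¹` lies in the subvariety. Here `S` is the spectrum of
an algebraically closed field `k`, and points are `k`-points. -/
structure ConjSubvariety {S : Scheme.{u}} (G : Over S) [GrpObj G] where
  obj : Over S
  incl : obj ⟶ G
  isVar : IsVar obj
  isReduced : IsReduced obj.left
  isImmersion : IsImmersion incl.left
  conj : ∀ (g : 𝟙_ (Over S) ⟶ G) (x : 𝟙_ (Over S) ⟶ obj),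
    ∃ y : 𝟙_ (Over S) ⟶ obj, y ≫ incl = g * (x ≫ incl) * g⁻¹

attribute [instance] ConjSubvariety.isVar ConjSubvariety.isReduced ConjSubvariety.isImmersion

/-- Evaluation of a word in the generators `i : I`, as a morphism `G^I ⟶ G`. -/
def evalWord {S : Scheme.{u}} (G : Over S) [GrpObj G] {I : Type} [Finite I] :
    FreeGroup I →* ((∏ᶜ fun _ : I => G) ⟶ G) :=
  FreeGroup.lift fun i => Pi.π (fun _ : I => G) i

/-- The evaluation of the relators and of the parabolic elements, `G^I ⟶ G^κ × G^σ`. -/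
def wordMap {S : Scheme.{u}} (G : Over S) [GrpObj G] {I κ σ : Type} [Finite I] [Finite κ]
    [Finite σ] (rel : κ → FreeGroup I) (w : σ → FreeGroup I) :
    (∏ᶜ fun _ : I => G) ⟶ (∏ᶜ fun _ : κ => G) ⊗ (∏ᶜ fun _ : σ => G) :=
  lift (Pi.lift fun c => evalWord G (rel c)) (Pi.lift fun j => evalWord G (w j))

/-- The inclusion `1 × ∏ j, Q j ⟶ G^κ × G^σ`. -/
def dataMap {S : Scheme.{u}} (G : Over S) [GrpObj G] (κ : Type) {σ : Type} [Finite κ]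
    [Finite σ] (Q : σ → ConjSubvariety G) :
    (∏ᶜ fun j => (Q j).obj) ⟶ (∏ᶜ fun _ : κ => G) ⊗ (∏ᶜ fun _ : σ => G) :=
  lift (Pi.lift fun _ => 1) (Limits.Pi.map fun j => (Q j).incl)

/-- The parabolic representation variety of the group `⟨I ∣ rel⟩` with parabolic structure
`{(w j, Q j)}`: the subvariety of `G^I` cut out by the equations `rel c = 1` and the
conditions `w j ∈ Q j`, that is, the fibre product of `(rel, w) : G^I ⟶ G^κ × G^σ` and
the inclusion `1 × ∏ j, Q j ⟶ G^κ × G^σ`. -/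
abbrev RepVariety {S : Scheme.{u}} (G : Over S) [GrpObj G] {I κ σ : Type} [Finite I] [Finite κ]
    [Finite σ] (rel : κ → FreeGroup I) (w : σ → FreeGroup I) (Q : σ → ConjSubvariety G) :
    Over S :=
  pullback (wordMap G rel w) (dataMap G κ Q)

/-- The embedding of the representation variety in `G^I`: the images of the generators. -/
abbrev RepVariety.emb {S : Scheme.{u}} (G : Over S) [GrpObj G] {I κ σ : Type} [Finite I] [Finite κ]
    [Finite σ] (rel : κ → FreeGroup I) (w : σ → FreeGroup I) (Q : σ → ConjSubvariety G) :
    RepVariety G rel w Q ⟶ ∏ᶜ fun _ : I => G :=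
  pullback.fst _ _

lemma comp_evalWord {S : Scheme.{u}} (G : Over S) [GrpObj G] {I : Type} [Finite I] {T : Over S}
    (f : T ⟶ ∏ᶜ fun _ : I => G) (v : FreeGroup I) :
    f ≫ evalWord G v = FreeGroup.lift (fun i => f ≫ Pi.π (fun _ : I => G) i) v := by
  let φ : FreeGroup I →* (T ⟶ G) :=
    MonoidHom.mk' (fun v => f ≫ evalWord G v) fun a b => by
      rw [map_mul, MonObj.comp_mul]
  have : φ = FreeGroup.lift (fun i => f ≫ Pi.π (fun _ : I => G) i) := by
    ext i; simp [φ, evalWord]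
  exact DFunLike.congr_fun this v

lemma comp_wordMap_eq_iff {S : Scheme.{u}} (G : Over S) [GrpObj G] {I κ σ : Type}
    [Finite I] [Finite κ] [Finite σ] (rel : κ → FreeGroup I) (w : σ → FreeGroup I)
    (Q : σ → ConjSubvariety G) {T : Over S} (p : T ⟶ ∏ᶜ fun _ : I => G)
    (q : T ⟶ ∏ᶜ fun j => (Q j).obj) :
    p ≫ wordMap G rel w = q ≫ dataMap G κ Q ↔
      (∀ c, FreeGroup.lift (fun i => p ≫ Pi.π (fun _ : I => G) i) (rel c) = 1) ∧
        ∀ j, FreeGroup.lift (fun i => p ≫ Pi.π (fun _ : I => G) i) (w j) =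
          (q ≫ Pi.π _ j) ≫ (Q j).incl := by
  simp only [← comp_evalWord]
  constructor
  · intro h
    have h1 := h =≫ fst _ _
    have h2 := h =≫ snd _ _
    simp only [wordMap, dataMap, Category.assoc, lift_fst, lift_snd] at h1 h2
    refine ⟨fun c => ?_, fun j => ?_⟩
    · simpa [MonObj.comp_one] using h1 =≫ Pi.π _ c
    · simpa using h2 =≫ Pi.π _ j
  · rintro ⟨h1, h2⟩
    apply CartesianMonoidalCategory.hom_ext
    · simp only [wordMap, dataMap, Category.assoc, lift_fst]
      refine Limits.Pi.hom_ext _ _ fun c => ?_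
      simpa [MonObj.comp_one] using h1 c
    · simp only [wordMap, dataMap, Category.assoc, lift_snd]
      refine Limits.Pi.hom_ext _ _ fun j => ?_
      simpa using h2 j

/-- The points of the representation variety with values in `T` are the representations `ρ` of the
presented group in the group of `T`-points of `G` such that `ρ (w j)` lies in `Q j` for all `j`. -/
theorem RepVariety.existsUnique_iff {S : Scheme.{u}} (G : Over S) [GrpObj G] {I κ σ : Type}
    [Finite I] [Finite κ] [Finite σ] (rel : κ → FreeGroup I) (w : σ → FreeGroup I)
    (Q : σ → ConjSubvariety G) (T : Over S) (A : I → (T ⟶ G)) :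
    (∃! f : T ⟶ RepVariety G rel w Q,
        ∀ i, f ≫ RepVariety.emb G rel w Q ≫ Pi.π (fun _ : I => G) i = A i) ↔
      ∃ ρ : PresentedGroup (Set.range rel) →* (T ⟶ G),
        (∀ i, ρ (PresentedGroup.of i) = A i) ∧
          ∀ j, ∃ y : T ⟶ (Q j).obj, y ≫ (Q j).incl = ρ (PresentedGroup.mk _ (w j)) := by
  have mono : ∀ j, Mono (Q j).incl := fun j =>
    have : Mono ((Over.forget S).map (Q j).incl) := inferInstanceAs (Mono (Q j).incl.left)
    (Over.forget S).mono_of_mono_map this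
  constructor
  · rintro ⟨f, hf, -⟩
    have hp : (fun i => (f ≫ RepVariety.emb G rel w Q) ≫ Pi.π (fun _ : I => G) i) = A :=
      funext fun i => by rw [Category.assoc, hf i]
    obtain ⟨h1, h2⟩ := (comp_wordMap_eq_iff G rel w Q (f ≫ RepVariety.emb G rel w Q)
      (f ≫ pullback.snd _ _)).1 (by
        rw [Category.assoc, Category.assoc]; exact f ≫= pullback.condition)
    rw [hp] at h1 h2
    exact ⟨PresentedGroup.toGroup (f := A) (by rintro _ ⟨c, rfl⟩; exact h1 c),
      fun i => PresentedGroup.toGroup.of _, fun j => ⟨_, (h2 j).symm⟩⟩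
  · rintro ⟨ρ, hρ, hy⟩
    choose y hy using hy
    have hlift : FreeGroup.lift A = ρ.comp (PresentedGroup.mk (Set.range rel)) := by
      refine FreeGroup.ext_hom _ _ fun i => ?_
      rw [FreeGroup.lift_apply_of]; exact (hρ i).symm
    have hA : (fun i => Pi.lift A ≫ Pi.π (fun _ : I => G) i) = A := by ext1 i; simp
    have hc : Pi.lift A ≫ wordMap G rel w = Pi.lift y ≫ dataMap G κ Q := by
      rw [comp_wordMap_eq_iff, hA, hlift]
      refine ⟨fun c => ?_, fun j => ?_⟩
      · have : PresentedGroup.mk (Set.range rel) (rel c) = 1 :=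
          PresentedGroup.one_of_mem ⟨c, rfl⟩
        simp [this]
      · simp [hy]
    refine ⟨pullback.lift _ _ hc, fun i => ?_, fun f hf => ?_⟩
    · rw [pullback.lift_fst_assoc]; simp
    · have h1 : f ≫ pullback.fst _ _ = Pi.lift A := Limits.Pi.hom_ext _ _ fun i => by
        rw [Category.assoc]; simpa using hf i
      refine pullback.hom_ext (h1.trans (pullback.lift_fst _ _ hc).symm) ?_
      refine Limits.Pi.hom_ext _ _ fun j => ?_
      have h2 : f ≫ pullback.fst (wordMap G rel w) (dataMap G κ Q) ≫ wordMap G rel w =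
        f ≫ pullback.snd _ _ ≫ dataMap G κ Q := f ≫= pullback.condition
      rw [← Category.assoc, ← Category.assoc, comp_wordMap_eq_iff] at h2
      have h3 := h2.2 j
      rw [h1, hA, hlift] at h3
      rw [← cancel_mono (Q j).incl, ← h3, pullback.lift_snd]
      simp [hy]

/-! ### Surfaces -/

/-- The generators `a i, b i` (`i < g`) and `c j` (`j < s`) of the fundamental group of the closed
oriented surface of genus `g` with `s` punctures. -/
inductive SurfaceGen (g s : ℕ) : Type
  | a (i : Fin g) : SurfaceGen g s
  | b (i : Fin g) : SurfaceGen g s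
  | c (j : Fin s) : SurfaceGen g s

instance (g s : ℕ) : Finite (SurfaceGen g s) :=
  Finite.of_surjective (α := (Fin g ⊕ Fin g) ⊕ Fin s)
    (Sum.elim (Sum.elim SurfaceGen.a SurfaceGen.b) SurfaceGen.c) (by
      rintro (i | i | j)
      exacts [⟨.inl (.inl i), rfl⟩, ⟨.inl (.inr i), rfl⟩, ⟨.inr j, rfl⟩])

/-- The relator `a₁ b₁ a₁⁻¹ b₁⁻¹ ⋯ a_g b_g a_g⁻¹ b_g⁻¹ c₁ ⋯ c_s`. -/
def surfaceRelator (g s : ℕ) : FreeGroup (SurfaceGen g s) :=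
  (List.ofFn fun i : Fin g =>
      FreeGroup.of (SurfaceGen.a (s := s) i) * FreeGroup.of (SurfaceGen.b i) *
        (FreeGroup.of (SurfaceGen.a i))⁻¹ * (FreeGroup.of (SurfaceGen.b i))⁻¹).prod *
    (List.ofFn fun j : Fin s => FreeGroup.of (SurfaceGen.c (g := g) j)).prod

/-- The meridian of the `j`-th puncture: the simple loop `c j`, or its inverse if the orientation of
the chosen disc around the puncture is opposite to that of the surface (`ε j = -1`). -/
def meridian {g s : ℕ} (ε : Fin s → ℤˣ) (j : Fin s) : FreeGroup (SurfaceGen g s) :=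
  FreeGroup.of (SurfaceGen.c j) ^ (ε j : ℤ)

/-- The parabolic representation variety of the closed oriented surface of genus `g` with `s` marked
points with data `Q j` and local orientations `ε j`. -/
def SurfaceRepVariety {S : Scheme.{u}} (G : Over S) [GrpObj G] (g s : ℕ)
    (Q : Fin s → ConjSubvariety G) (ε : Fin s → ℤˣ) : Over S :=
  RepVariety G (fun _ : Unit => surfaceRelator g s) (meridian ε) Q

instance {S : Scheme.{u}} (G : Over S) [GrpObj G] [IsVar G] (g s : ℕ)
    (Q : Fin s → ConjSubvariety G) (ε : Fin s → ℤˣ) : IsVar (SurfaceRepVariety G g s Q ε) := by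
  unfold SurfaceRepVariety; infer_instance

/-! ### The homomorphisms attached to discs and tubes -/

section Bordisms

variable {S : Scheme.{u}} (G : Over S) [GrpObj G] [IsVar G]

/-- The disc `D`: the push-forward `i_!` along the inclusion `i` of the unit. -/
def zDisc : K0 S →+ K0 G.left :=
  push (S := S) η[G].left (varMor_left η[G])

/-- The opposite disc `D†`: the pullback `i^*` along the inclusion `i` of the unit. -/
def zDiscDagger : K0 G.left →+ K0 S :=
  (pull (S := S) η[G].left).toAddMonoidHom

/-- The holed torus `L`: the span `G ⟵ G⁴ ⟶ G`, with legs `(x, a, b, h) ↦ x` and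
`(x, a, b, h) ↦ h x (a b a⁻¹ b⁻¹) h⁻¹`. -/
def zHoledTorus : AddMonoid.End (K0 G.left) :=
  let x : G ⊗ G ⊗ G ⊗ G ⟶ G := fst _ _
  let a : G ⊗ G ⊗ G ⊗ G ⟶ G := snd _ _ ≫ fst _ _
  let b : G ⊗ G ⊗ G ⊗ G ⟶ G := snd _ _ ≫ snd _ _ ≫ fst _ _
  let h : G ⊗ G ⊗ G ⊗ G ⟶ G := snd _ _ ≫ snd _ _ ≫ snd _ _
  pushPull x (h * x * (a * b * a⁻¹ * b⁻¹) * h⁻¹)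

/-- The tube with a marked point with datum `Q`, whose local orientation is given by the sign `e`:
the span `G ⟵ G² × Q ⟶ G`, with legs `(x, h, ξ) ↦ x` and `(x, h, ξ) ↦ h x ξᵉ h⁻¹`. -/
def zTube (Q : ConjSubvariety G) (e : ℤˣ) : AddMonoid.End (K0 G.left) :=
  let x : G ⊗ G ⊗ Q.obj ⟶ G := fst _ _
  let h : G ⊗ G ⊗ Q.obj ⟶ G := snd _ _ ≫ fst _ _
  let ξ : G ⊗ G ⊗ Q.obj ⟶ G := snd _ _ ≫ snd _ _ ≫ Q.incl
  pushPull x (h * x * ξ ^ (e : ℤ) * h⁻¹)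

/-- The composite `Z(D†) ∘ Z(L_{λ_s}) ∘ ⋯ ∘ Z(L_{λ_1}) ∘ Z(L)^g ∘ Z(D)`. -/
def zSurface (g s : ℕ) (Q : Fin s → ConjSubvariety G) (ε : Fin s → ℤˣ) : K0 S →+ K0 S :=
  (zDiscDagger G).comp
    (AddMonoidHom.comp ((List.ofFn fun j : Fin s => zTube G (Q j) (ε j)).reverse.prod)
      (AddMonoidHom.comp (zHoledTorus G ^ g) (zDisc G)))

end Bordisms

end RepTQFT
end

noncomputable section

namespace RepTQFT

/-! ### Reduced subschemes and factorisation through immersions -/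

/-! Let C be the operator that sends a family y : Y → G to (y, h) ↦ h y h⁻¹ on Y × G, and for c : D
→ G let M_c send it to (y, d) ↦ y c(d) on Y × D. Separating the conjugating variable from the others
gives Z(L) = C ∘ M_c with c the commutator map, and Z(L_λ) = C ∘ M_c with c(ξ) = ξ^ε
(`zHoledTorus_eq`, `zTube_eq`).

C commutes with each of these M_c: substitute a ↦ h a h⁻¹, b ↦ h b h⁻¹, respectively ξ ↦ h ξ h⁻¹. So
all g + s copies of C can be moved next to Z(D†), where each contributes a factor [G]: since h x h⁻¹
= 1 exactly when x = 1, the fibre over 1 is multiplied by G (`zDiscDagger_conjugation`). The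
remaining M_c, applied to the unit of G, give the map ∏ [a_i, b_i] ∏ ξ_j^{ε_j} on G^{2g} × ∏ λ_j
(`convolution_list_relCls`). Its fibre over 1 is the representation variety, with C_j = ξ_j^{ε_j}
(`SurfaceRepVariety.isPullback`).

The delicate point is ξ ↦ h ξ h⁻¹, because invariance of λ_j is given on k-points only. Over an
algebraically closed field it extends to points with values in reduced varieties
(`ConjSubvariety.exists_conj`), and this suffices because classes in the Grothendieck ring do not
see nilpotents (`relCls_eq_of_factors`). -/

/-- Every scheme has a closed subscheme which is reduced and has the same points. -/
lemma exists_reduced (X : Scheme.{u}) : ∃ (Z : Scheme.{u}) (i : Z ⟶ X),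
    IsReduced Z ∧ IsClosedImmersion i ∧ Surjective i := by
  refine ⟨X.nilradical.subscheme, X.nilradical.subschemeι, ?_, inferInstance, ⟨?_⟩⟩
  · have (U : X.affineOpens) : IsReduced (X.nilradical.subschemeCover.openCover.X U) := by
      have : _root_.IsReduced (Γ(X, U) ⧸ X.nilradical.ideal U) := by
        rw [← Ideal.isRadical_iff_quotient_reduced]
        exact Ideal.radical_isRadical _
      exact inferInstanceAs (IsReduced (Spec (.of (Γ(X, U) ⧸ X.nilradical.ideal U))))
    have (U : X.nilradical.subschemeCover.openCover.I₀) :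
      IsReduced (X.nilradical.subschemeCover.openCover.X U) := this U
    exact IsReduced.of_openCover (𝒰 := X.nilradical.subschemeCover.openCover)
  · rw [← Set.range_eq_univ, Scheme.IdealSheafData.range_subschemeι]
    rfl

/-- A morphism from a reduced scheme factors through every immersion whose image contains its
image. -/
lemma exists_lift_of_range_subset {T X Y : Scheme.{u}} [IsReduced T] (f : T ⟶ Y) (i : X ⟶ Y)
    [IsImmersion i] (h : Set.range f ⊆ Set.range i) : ∃ g : T ⟶ X, g ≫ i = f := by
  -- The base change of `i` to `T` is a surjective immersion, hence a closed one, hence an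
  -- isomorphism because `T` is reduced; its inverse gives the factorisation.
  have hs : Set.range (pullback.fst f i) = Set.univ := by
    rw [Scheme.Pullback.range_fst, Set.eq_univ_iff_forall]
    exact fun x => h ⟨x, rfl⟩
  have : Surjective (pullback.fst f i) := ⟨Set.range_eq_univ.1 hs⟩
  have : IsClosedImmersion (pullback.fst f i) :=
    .of_isPreimmersion _ (hs ▸ isClosed_univ)
  have := isIso_of_isClosedImmersion_of_surjective (pullback.fst f i)
  exact ⟨inv (pullback.fst f i) ≫ pullback.snd f i, by
    rw [Category.assoc, ← pullback.condition, IsIso.inv_hom_id_assoc]⟩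

/-- A locally closed subset of a Jacobson space which contains all closed points is everything. -/
lemma eq_univ_of_closedPoints_subset {X : Type*} [TopologicalSpace X] [JacobsonSpace X] {s : Set X}
    (hs : IsLocallyClosed s) (h : closedPoints X ⊆ s) : s = Set.univ := by
  have hd : closure s = Set.univ := Set.univ_subset_iff.1 <| by
    rw [← closure_closedPoints]
    exact closure_mono h
  -- The coborder of `s` is the complement of `closure s \ s`: open because `s` is locally closed,
  -- and equal to `s` because `s` is dense.
  have ho : IsOpen s := by
    have := hs.isOpen_coborder
    rwa [coborder, hd, ← Set.compl_eq_univ_sdiff, compl_compl] at this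
  by_contra hne
  obtain ⟨x, hx, hxc⟩ := nonempty_inter_closedPoints (Set.nonempty_compl.2 hne)
    ho.isClosed_compl.isLocallyClosed
  exact hx (h hxc)

/-- Over an algebraically closed field, a morphism from a reduced scheme locally of finite type
factors through an immersion if this holds on rational points. -/
lemma exists_lift_of_points {k : Type u} [Field k] [IsAlgClosed k] {T X Y : Over (Spec (.of k))}
    [IsReduced T.left] [IsVar T] (f : T ⟶ Y) (i : X ⟶ Y) [IsImmersion i.left]
    (h : ∀ t : 𝟙_ (Over (Spec (.of k))) ⟶ T, ∃ x : 𝟙_ (Over (Spec (.of k))) ⟶ X,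
      x ≫ i = t ≫ f) : ∃ g : T ⟶ X, g ≫ i = f := by
  have : LocallyOfFiniteType T.hom := (‹IsVar T›.out).2.1
  have := LocallyOfFiniteType.jacobsonSpace T.hom
  have hu : f.left ⁻¹' Set.range i.left = Set.univ := by
    refine eq_univ_of_closedPoints_subset
      (i.left.isLocallyClosed_range.preimage f.left.continuous) fun t ht => ?_
    -- As `k` is algebraically closed, the closed point `t` is the image of a `k`-point, to which
    -- `h` applies.
    obtain ⟨x, hx⟩ := h (Over.homMk (pointOfClosedPoint T.hom t ht)
      (pointOfClosedPoint_comp T.hom t ht))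
    refine ⟨x.left (IsLocalRing.closedPoint k), ?_⟩
    have := congr(($hx).left (IsLocalRing.closedPoint k))
    exact this.trans (congrArg f.left (pointOfClosedPoint_apply T.hom t ht _))
  obtain ⟨g, hg⟩ := exists_lift_of_range_subset f.left i.left (by
    rintro _ ⟨t, rfl⟩
    exact (hu ▸ Set.mem_univ t : t ∈ f.left ⁻¹' Set.range i.left))
  exact ⟨Over.homMk g (by rw [← Over.w i, ← Category.assoc, hg, Over.w]), by ext; exact hg⟩

/-- The points of a conjugation-invariant subvariety with values in a reduced variety are stable
under conjugation. -/
lemma ConjSubvariety.exists_conj {k : Type u} [Field k] [IsAlgClosed k] {G : Over (Spec (.of k))}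
    [GrpObj G] (Q : ConjSubvariety G) {T : Over (Spec (.of k))} [IsReduced T.left] [IsVar T]
    (g : T ⟶ G) (x : T ⟶ Q.obj) : ∃ y : T ⟶ Q.obj, y ≫ Q.incl = g * (x ≫ Q.incl) * g⁻¹ := by
  refine exists_lift_of_points _ _ fun t => ?_
  obtain ⟨y, hy⟩ := Q.conj (t ≫ g) (t ≫ x)
  exact ⟨y, by simp [hy, MonObj.comp_mul, GrpObj.comp_inv]⟩

/-! ### Classes of morphisms of varieties -/

section Classes

variable {S : Scheme.{u}}

/-- The class `[Y ⟶ B]` in the Grothendieck ring of varieties over `B`. -/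
def relCls {Y B : Over S} [IsVar Y] [IsVar B] (f : Y ⟶ B) : K0 B.left :=
  K0.cls (Over.mk f.left) (varMor_left f)

lemma virtualClass_tensor (X Y : Over S) [hX : IsVar X] [hY : IsVar Y] :
    virtualClass (X ⊗ Y) = virtualClass X * virtualClass Y :=
  (congrArg (K0.mk S) (gen_mul ⟨X, hX.out⟩ ⟨Y, hY.out⟩)).symm.trans (map_mul _ _ _)

lemma relCls_eq_of_iso {Y Y' B : Over S} [IsVar Y] [IsVar Y'] [IsVar B] {f : Y ⟶ B}
    {f' : Y' ⟶ B} (e : Y ≅ Y') (h : e.hom ≫ f' = f) : relCls f = relCls f' :=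
  congrArg (K0.mk B.left) (gen_eq_of_iso (Over.isoMk ((Over.forget S).mapIso e)
    congr(($h).left)))

/-- On an empty scheme the identity is a closed immersion and also the complementary open one, so
cut-and-paste reads [Y] = [Y] + [Y]. -/
lemma K0.mk_gen_of_isEmpty {T : Scheme.{u}} (Y : VarOver T) [IsEmpty Y.1.left] :
    K0.mk T (gen Y) = 0 := by
  have := mk_eq_zero_of_decomposition (Y := Y) (Z := Y) (U := Y)
    ⟨𝟙 _, 𝟙 _, inferInstanceAs (IsClosedImmersion (𝟙 Y.1.left)),
      inferInstanceAs (IsOpenImmersion (𝟙 Y.1.left)), Subsingleton.elim _ _⟩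
  simpa using this

/-- A variety and a closed subvariety with the same points have the same class. -/
lemma relCls_comp_of_surjective {Z Y B : Over S} [IsVar Z] [IsVar Y] [IsVar B] (i : Z ⟶ Y)
    [IsClosedImmersion i.left] [Surjective i.left] (f : Y ⟶ B) :
    relCls (i ≫ f) = relCls f := by
  -- The open complement of a surjective closed immersion is empty and has class zero.
  let U : VarOver B.left := ⟨Over.mk (Scheme.emptyTo B.left), by
    have : IsOpenImmersion (Scheme.emptyTo B.left) := inferInstance
    exact ⟨inferInstanceAs (IsSeparated (Scheme.emptyTo B.left)),
      inferInstanceAs (LocallyOfFiniteType (Scheme.emptyTo B.left)),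
      ⟨fun s _ _ => (Set.toFinite (Scheme.emptyTo B.left ⁻¹' s)).isCompact⟩⟩⟩
  let Y₁ : VarOver B.left := ⟨Over.mk f.left, varMor_left f⟩
  let Z₁ : VarOver B.left := ⟨Over.mk (i ≫ f).left, varMor_left (i ≫ f)⟩
  have : IsEmpty U.1.left := inferInstanceAs (IsEmpty (∅ : Scheme.{u}))
  have := mk_eq_zero_of_decomposition (Y := Y₁) (Z := Z₁) (U := U)
    ⟨Over.homMk i.left, Over.homMk (Scheme.emptyTo Y.left) (emptyIsInitial.hom_ext _ _), ‹_›,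
      inferInstanceAs (IsOpenImmersion (Scheme.emptyTo Y.left)), by
        have h1 : Set.range i.left = Set.univ := Set.range_eq_univ.2 i.left.surjective
        have h2 : Set.range (Scheme.emptyTo Y.left) = ∅ := Set.range_eq_empty _
        exact h1.trans (by rw [← Set.compl_empty, ← h2]; rfl)⟩
  rw [map_sub, map_sub, K0.mk_gen_of_isEmpty U, sub_zero, sub_eq_zero] at this
  exact this.symm

/-- Additive maps out of the Grothendieck ring are determined by the classes of morphisms. -/
lemma hom_ext_relCls {B : Over S} [hB : IsVar B] {A : Type*} [AddCommGroup A]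
    {φ ψ : K0 B.left →+ A}
    (h : ∀ (Y : Over S) [IsVar Y] (f : Y ⟶ B), φ (relCls f) = ψ (relCls f)) : φ = ψ := by
  refine QuotientAddGroup.addMonoidHom_ext _ (FreeAbelianGroup.lift_ext _ _ fun y => ?_)
  obtain ⟨Y, rfl⟩ := Quotient.exists_rep y
  -- A variety over `B` is also one over `S`, so every generator is the class of a morphism of
  -- `S`-varieties.
  have : IsVar (Over.mk (Y.1.hom ≫ B.hom)) := ⟨varMor.comp_mem _ _ Y.2 hB.out⟩
  exact h (Over.mk (Y.1.hom ≫ B.hom)) (Over.homMk Y.1.hom)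

lemma push_relCls {Y A B : Over S} [IsVar Y] [IsVar A] [IsVar B] (f : Y ⟶ A) (g : A ⟶ B) :
    push g.left (varMor_left g) (relCls f) = relCls (f ≫ g) :=
  push_cls _ _ _ _

/-- The forgetful functor to schemes preserves pullback squares, so any square over `S` computes the
base change. -/
lemma pull_relCls {Y A D P : Over S} [IsVar Y] [IsVar A] [IsVar D] [IsVar P] {y : Y ⟶ A}
    {f : D ⟶ A} {p : P ⟶ Y} {q : P ⟶ D} (h : IsPullback p q y f) :
    pull f.left (relCls y) = relCls q := by
  have h' := h.map (Over.forget S)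
  refine (pull_cls f.left (Over.mk y.left) (varMor_left y)).trans ?_
  exact congrArg (K0.mk D.left) (gen_eq_of_iso (Over.isoMk h'.isoPullback.symm
    h'.isoPullback_inv_snd))

lemma pushPull_relCls {Y A B D P : Over S} [IsVar Y] [IsVar A] [IsVar B] [IsVar D] [IsVar P]
    {y : Y ⟶ A} {f : D ⟶ A} {p : P ⟶ Y} {q : P ⟶ D} (h : IsPullback p q y f) (g : D ⟶ B) :
    pushPull f g (relCls y) = relCls (q ≫ g) := by
  rw [← push_relCls, ← pull_relCls h]
  rfl

lemma isPullback_whiskerRight {C : Type*} [Category* C] [CartesianMonoidalCategory C]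
    {Y A : C} (y : Y ⟶ A) (D : C) : IsPullback (fst Y D) (y ▷ D) y (fst A D) :=
  IsPullback.of_isLimit' ⟨by simp⟩ <| PullbackCone.IsLimit.mk _
    (fun s => lift s.fst (s.snd ≫ snd A D)) (fun s => by simp)
    (fun s => by
      apply CartesianMonoidalCategory.hom_ext
      · simp [s.condition]
      · simp)
    (fun s m h1 h2 => by
      apply CartesianMonoidalCategory.hom_ext
      · simp [h1]
      · simp [← h2])

/-- Every span of the construction has a projection as its left leg; its base change along `y` is
just `Y ⊗ D`. -/
lemma pushPull_fst_relCls {Y A B D : Over S} [IsVar Y] [IsVar A] [IsVar B] [IsVar D]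
    (y : Y ⟶ A) (m : A ⊗ D ⟶ B) : pushPull (fst A D) m (relCls y) = relCls (y ▷ D ≫ m) :=
  pushPull_relCls (isPullback_whiskerRight y D) m

lemma isVar_of_isClosedImmersion {Z Y : Over S} [hY : IsVar Y] (i : Z ⟶ Y)
    [IsClosedImmersion i.left] : IsVar Z := by
  refine ⟨?_⟩
  rw [← Over.w i]
  exact varMor.comp_mem _ _ ⟨inferInstance, inferInstance, inferInstance⟩ hY.out

lemma mono_of_mono_left {Z Y : Over S} (i : Z ⟶ Y) [h : Mono i.left] : Mono i :=
  have : Mono ((Over.forget S).map i) := h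
  (Over.forget S).mono_of_mono_map this

/-- Two subvarieties of `W` with the same points in reduced varieties have the same class. -/
lemma relCls_eq_of_factors {Y Y' W B : Over S} [IsVar Y] [IsVar Y'] [IsVar B]
    (j : Y ⟶ W) (j' : Y' ⟶ W) [Mono j] [Mono j'] (f : W ⟶ B)
    (h : ∀ (T : Over S) [IsVar T] [IsReduced T.left] (t : T ⟶ W),
      (∃ a : T ⟶ Y, a ≫ j = t) ↔ ∃ a : T ⟶ Y', a ≫ j' = t) :
    relCls (j ≫ f) = relCls (j' ≫ f) := by
  obtain ⟨Z, i, hZ, hi, hi'⟩ : ∃ (Z : Over S) (i : Z ⟶ Y), IsReduced Z.left ∧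
      IsClosedImmersion i.left ∧ Surjective i.left := by
    obtain ⟨Z, i, hZ⟩ := exists_reduced Y.left
    exact ⟨Over.mk (i ≫ Y.hom), Over.homMk i, hZ⟩
  obtain ⟨Z', i', hZ', hi₁, hi₁'⟩ : ∃ (Z : Over S) (i : Z ⟶ Y'), IsReduced Z.left ∧
      IsClosedImmersion i.left ∧ Surjective i.left := by
    obtain ⟨Z, i, hZ⟩ := exists_reduced Y'.left
    exact ⟨Over.mk (i ≫ Y'.hom), Over.homMk i, hZ⟩
  have hlift {T Z Y : Over S} [IsReduced T.left] (a : T ⟶ Y) (i : Z ⟶ Y)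
      [IsClosedImmersion i.left] [Surjective i.left] : ∃ b : T ⟶ Z, b ≫ i = a := by
    obtain ⟨b, hb⟩ := exists_lift_of_range_subset a.left i.left
      fun x _ => i.left.surjective x
    exact ⟨Over.homMk b (by rw [← Over.w i, ← Category.assoc, hb, Over.w]), by ext; exact hb⟩
  have := isVar_of_isClosedImmersion i
  have := isVar_of_isClosedImmersion i'
  have := mono_of_mono_left i
  have := mono_of_mono_left i'
  -- The reductions `Z` and `Z'` are themselves admissible test objects. Each maps to the other
  -- variety over `W`, hence to the other reduction, and the two maps are inverse because everything
  -- embeds in `W`.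
  obtain ⟨a, ha⟩ := (h Z (i ≫ j)).1 ⟨i, rfl⟩
  obtain ⟨b, hb⟩ := (h Z' (i' ≫ j')).2 ⟨i', rfl⟩
  obtain ⟨a, rfl⟩ := hlift a i'
  obtain ⟨b, rfl⟩ := hlift b i
  rw [← relCls_comp_of_surjective i (j ≫ f), ← relCls_comp_of_surjective i' (j' ≫ f)]
  refine relCls_eq_of_iso ⟨a, b, ?_, ?_⟩ ?_
  · rw [← cancel_mono (i ≫ j), Category.assoc, ← Category.assoc b, hb, ← Category.assoc, ha,
      Category.id_comp]
  · rw [← cancel_mono (i' ≫ j'), Category.assoc, ← Category.assoc a, ha, ← Category.assoc, hb,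
      Category.id_comp]
  · simp only [← Category.assoc] at ha ⊢
    rw [ha]

end Classes

/-! ### Conjugation and convolution operators -/

section Operators

variable {S : Scheme.{u}}

lemma end_ext_relCls {B : Over S} [IsVar B] {φ ψ : AddMonoid.End (K0 B.left)}
    (h : ∀ (Y : Over S) [IsVar Y] (f : Y ⟶ B), φ (relCls f) = ψ (relCls f)) : φ = ψ :=
  hom_ext_relCls h

lemma toUnit_comp_one {G : Over S} [GrpObj G] (T : Over S) : toUnit T ≫ η[G] = (1 : T ⟶ G) :=
  rfl

/-- Uniqueness is automatic, from `p` being mono and the unit object being terminal; only the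
existence of factorisations is left to check. -/
lemma isPullback_one {G : Over S} [GrpObj G] {Y P : Over S} {y : Y ⟶ G} {p : P ⟶ Y} [Mono p] (hp : p ≫ y = 1)
    (h : ∀ (T : Over S) (t : T ⟶ Y), t ≫ y = 1 → ∃ a : T ⟶ P, a ≫ p = t) :
    IsPullback p (toUnit P) y η[G] := by
  have h' (s : PullbackCone y η[G]) := h s.pt s.fst
    (s.condition.trans (by rw [← toUnit_comp_one]; congr 1; exact toUnit_unique _ _))
  choose a ha using h'
  exact IsPullback.of_isLimit' ⟨hp⟩ <| PullbackCone.IsLimit.mk _ a ha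
    (fun s => toUnit_unique _ _) fun s m h1 _ => by rw [← cancel_mono p, h1, ha]

variable {G : Over S} [GrpObj G] [IsVar G]

variable (G) in
/-- The operator which conjugates by all elements of `G`: the span `G ⟵ G² ⟶ G` with legs
`(x, h) ↦ x` and `(x, h) ↦ h x h⁻¹`. -/
def conjugation : AddMonoid.End (K0 G.left) :=
  pushPull (fst G G) (snd G G * fst G G * (snd G G)⁻¹)

/-- The operator which multiplies from the right by the elements of a family `c : D ⟶ G`: the span
`G ⟵ G × D ⟶ G` with legs `(x, d) ↦ x` and `(x, d) ↦ x (c d)`. -/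
def convolution {D : Over S} [IsVar D] (c : D ⟶ G) : AddMonoid.End (K0 G.left) :=
  pushPull (fst G D) (fst G D * snd G D ≫ c)

lemma conjugation_relCls {Y : Over S} [IsVar Y] (y : Y ⟶ G) :
    conjugation G (relCls y) = relCls (snd Y G * fst Y G ≫ y * (snd Y G)⁻¹) := by
  refine (pushPull_fst_relCls y _).trans (congrArg relCls ?_)
  simp [MonObj.comp_mul, GrpObj.comp_inv]

lemma convolution_relCls {Y D : Over S} [IsVar Y] [IsVar D] (c : D ⟶ G) (y : Y ⟶ G) :
    convolution c (relCls y) = relCls (fst Y D ≫ y * snd Y D ≫ c) := by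
  refine (pushPull_fst_relCls y _).trans (congrArg relCls ?_)
  simp [MonObj.comp_mul]

/-- The commutator `(a, b) ↦ a b a⁻¹ b⁻¹` of a group object. -/
abbrev commutatorMap (G : Over S) [GrpObj G] : G ⊗ G ⟶ G :=
  fst G G * snd G G * (fst G G)⁻¹ * (snd G G)⁻¹

/-- The product of operators is composition, so `x` is first multiplied by [a, b] and then
conjugated; the parameter spaces differ by reassociation only. -/
lemma zHoledTorus_eq : zHoledTorus G = conjugation G * convolution (commutatorMap G) := by
  refine end_ext_relCls fun Y _ y => ?_
  rw [AddMonoid.End.coe_mul, Function.comp_apply, convolution_relCls, conjugation_relCls]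
  refine (pushPull_fst_relCls y _).trans (relCls_eq_of_iso
    ((Iso.refl Y ⊗ᵢ (α_ G G G).symm) ≪≫ (α_ Y (G ⊗ G) G).symm) ?_)
  simp [MonObj.comp_mul, GrpObj.comp_inv, _root_.mul_assoc]

lemma zTube_eq (Q : ConjSubvariety G) (e : ℤˣ) :
    zTube G Q e = conjugation G * convolution (Q.incl ^ (e : ℤ)) := by
  refine end_ext_relCls fun Y _ y => ?_
  rw [AddMonoid.End.coe_mul, Function.comp_apply, convolution_relCls, conjugation_relCls]
  refine (pushPull_fst_relCls y _).trans (relCls_eq_of_iso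
    ((Iso.refl Y ⊗ᵢ β_ G Q.obj) ≪≫ (α_ Y Q.obj G).symm) ?_)
  simp [MonObj.comp_mul, GrpObj.comp_inv, GrpObj.comp_zpow, _root_.mul_assoc]

lemma commute_conjugation_commutator :
    Commute (conjugation G) (convolution (commutatorMap G)) := by
  refine end_ext_relCls fun Y _ y => ?_
  rw [AddMonoid.End.coe_mul, Function.comp_apply, AddMonoid.End.coe_mul, Function.comp_apply, convolution_relCls, conjugation_relCls,
    conjugation_relCls, convolution_relCls]
  let y₁ : (Y ⊗ G ⊗ G) ⊗ G ⟶ Y := fst _ _ ≫ fst _ _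
  let a₁ : (Y ⊗ G ⊗ G) ⊗ G ⟶ G := fst _ _ ≫ snd _ _ ≫ fst _ _
  let b₁ : (Y ⊗ G ⊗ G) ⊗ G ⟶ G := fst _ _ ≫ snd _ _ ≫ snd _ _
  let h₁ : (Y ⊗ G ⊗ G) ⊗ G ⟶ G := snd _ _
  let y₂ : (Y ⊗ G) ⊗ G ⊗ G ⟶ Y := fst _ _ ≫ fst _ _
  let h₂ : (Y ⊗ G) ⊗ G ⊗ G ⟶ G := fst _ _ ≫ snd _ _
  let a₂ : (Y ⊗ G) ⊗ G ⊗ G ⟶ G := snd _ _ ≫ fst _ _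
  let b₂ : (Y ⊗ G) ⊗ G ⊗ G ⟶ G := snd _ _ ≫ snd _ _
  refine relCls_eq_of_iso
    -- Conjugating both entries by `h` conjugates the commutator: h y [a, b] h⁻¹ = (h y h⁻¹) [h a
    -- h⁻¹, h b h⁻¹].
    ⟨lift (lift y₁ h₁) (lift (h₁ * a₁ * h₁⁻¹) (h₁ * b₁ * h₁⁻¹)),
      lift (lift y₂ (lift (h₂⁻¹ * a₂ * h₂) (h₂⁻¹ * b₂ * h₂))) h₂, ?_, ?_⟩ ?_
  · ext <;> simp [y₁, a₁, b₁, h₁, y₂, a₂, b₂, h₂, MonObj.comp_mul, GrpObj.comp_inv, _root_.mul_assoc]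
  · ext <;> simp [y₁, a₁, b₁, h₁, y₂, a₂, b₂, h₂, MonObj.comp_mul, GrpObj.comp_inv, _root_.mul_assoc]
  · simp [y₁, a₁, b₁, h₁, MonObj.comp_mul, GrpObj.comp_inv, _root_.mul_assoc]

/-- The substitution ξ ↦ h ξ h⁻¹ is not constructed as an isomorphism. Instead both parameter spaces
are embedded in Y × G × G, by (y, h, h ξ h⁻¹) and by (y, h, ξ), and shown to have the same points in
reduced varieties. -/
lemma commute_conjugation_conjSubvariety {k : Type u} [Field k] [IsAlgClosed k]
    {G : Over (Spec (.of k))} [GrpObj G] [IsVar G] (Q : ConjSubvariety G) (n : ℤ) :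
    Commute (conjugation G) (convolution (Q.incl ^ n)) := by
  refine end_ext_relCls fun Y _ y => ?_
  rw [AddMonoid.End.coe_mul, Function.comp_apply, AddMonoid.End.coe_mul, Function.comp_apply, convolution_relCls, conjugation_relCls,
    conjugation_relCls, convolution_relCls]
  have hi : Mono Q.incl := mono_of_mono_left Q.incl
  let W := (Y ⊗ G) ⊗ G
  let y₀ : W ⟶ Y := fst _ _ ≫ fst _ _
  let h₀ : W ⟶ G := fst _ _ ≫ snd _ _
  let x₀ : W ⟶ G := snd _ _
  let h₁ : (Y ⊗ Q.obj) ⊗ G ⟶ G := snd _ _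
  let ξ₁ : (Y ⊗ Q.obj) ⊗ G ⟶ Q.obj := fst _ _ ≫ snd _ _
  let j₁ : (Y ⊗ Q.obj) ⊗ G ⟶ W :=
    lift (lift (fst _ _ ≫ fst _ _) h₁) (h₁ * (ξ₁ ≫ Q.incl) * h₁⁻¹)
  let j₂ : (Y ⊗ G) ⊗ Q.obj ⟶ W := (Y ⊗ G) ◁ Q.incl
  have hj₁ {T : Over (Spec (.of k))} (t : T ⟶ W) :
      (∃ a, a ≫ j₁ = t) ↔ ∃ ξ, ξ ≫ Q.incl = (t ≫ h₀)⁻¹ * (t ≫ x₀) * (t ≫ h₀) := by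
    constructor
    · rintro ⟨a, rfl⟩
      exact ⟨a ≫ ξ₁, by simp [j₁, h₀, x₀, h₁, MonObj.comp_mul, GrpObj.comp_inv, _root_.mul_assoc]⟩
    · rintro ⟨ξ, hξ⟩
      refine ⟨lift (lift (t ≫ y₀) ξ) (t ≫ h₀), ?_⟩
      ext <;> simp [j₁, ξ₁, y₀, h₀, x₀, h₁, MonObj.comp_mul, GrpObj.comp_inv, hξ, _root_.mul_assoc]
  have hj₂ {T : Over (Spec (.of k))} (t : T ⟶ W) :
      (∃ a, a ≫ j₂ = t) ↔ ∃ ξ, ξ ≫ Q.incl = t ≫ x₀ := by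
    constructor
    · rintro ⟨a, rfl⟩
      exact ⟨a ≫ snd _ _, by simp [j₂, x₀]⟩
    · rintro ⟨ξ, hξ⟩
      refine ⟨lift (t ≫ fst _ _) ξ, ?_⟩
      ext <;> simp [j₂, x₀, hξ]
  have : Mono j₁ := ⟨fun a b hab => by
    have h1 := hab =≫ h₀
    have h2 := hab =≫ y₀
    have h3 := hab =≫ x₀
    simp only [j₁, h₀, y₀, x₀, Category.assoc, lift_fst, lift_snd, lift_fst_assoc,
      MonObj.comp_mul, GrpObj.comp_inv] at h1 h2 h3
    rw [h1, mul_left_inj, mul_right_inj, ← Category.assoc a, ← Category.assoc b, cancel_mono] at h3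
    ext : 1
    · ext : 1
      · simpa using h2
      · simpa [ξ₁] using h3
    · exact h1⟩
  have : Mono j₂ := ⟨fun a b hab => by
    have h1 := hab =≫ fst _ _
    have h2 := hab =≫ x₀
    simp only [j₂, x₀, Category.assoc, whiskerLeft_fst, whiskerLeft_snd] at h1 h2
    ext : 1
    · exact h1
    · rw [← cancel_mono Q.incl]
      simpa using h2⟩
  -- Both families are restrictions of (y, h, x) ↦ h y h⁻¹ xⁿ, because h y h⁻¹ (h ξ h⁻¹)ⁿ = h y ξⁿ
  -- h⁻¹.
  convert relCls_eq_of_factors j₁ j₂ (h₀ * (y₀ ≫ y) * h₀⁻¹ * x₀ ^ n) ?_ using 2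
  · simp only [j₁, h₀, y₀, x₀, MonObj.comp_mul, GrpObj.comp_inv, GrpObj.comp_zpow, conj_zpow,
      lift_fst_assoc, lift_snd, h₁, ξ₁, Category.assoc]
    simp [_root_.mul_assoc]
  · simp [j₂, h₀, y₀, x₀, MonObj.comp_mul, GrpObj.comp_inv, GrpObj.comp_zpow]
  · intro T _ _ t
    rw [hj₁, hj₂]
    constructor
    · rintro ⟨ξ, hξ⟩
      obtain ⟨ξ', hξ'⟩ := Q.exists_conj (t ≫ h₀) ξ
      exact ⟨ξ', by rw [hξ', hξ]; group⟩
    · rintro ⟨ξ, hξ⟩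
      obtain ⟨ξ', hξ'⟩ := Q.exists_conj (t ≫ h₀)⁻¹ ξ
      exact ⟨ξ', by rw [hξ', hξ, inv_inv]⟩

/-! ### Discs -/

lemma relCls_toUnit (P : Over S) [IsVar P] :
    (relCls (toUnit P) : K0 (𝟙_ (Over S)).left) = (virtualClass P : K0 S) :=
  congrArg (K0.mk S) (gen_eq_of_iso (Over.isoMk (Iso.refl _) (by
    simp)))

lemma zDisc_one : zDisc G 1 = relCls η[G] :=
  (push_relCls (𝟙 (𝟙_ (Over S))) η[G]).trans (congrArg relCls (Category.id_comp _))

lemma zDiscDagger_relCls {Y P : Over S} [IsVar Y] [IsVar P] {y : Y ⟶ G} {p : P ⟶ Y}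
    (h : IsPullback p (toUnit P) y η[G]) : zDiscDagger G (relCls y) = virtualClass P :=
  (pull_relCls h).trans (relCls_toUnit P)

/-- If `P` is the fibre of `y` over 1, then the fibre of (y, h) ↦ h y h⁻¹ over 1 is P × G, as a
conjugate is trivial only if the element is. -/
lemma zDiscDagger_conjugation (x : K0 G.left) :
    zDiscDagger G (conjugation G x) = virtualClass G * zDiscDagger G x := by
  suffices h : (zDiscDagger G).comp (conjugation G) =
      (AddMonoidHom.mulLeft (virtualClass G)).comp (zDiscDagger G) from DFunLike.congr_fun h x
  refine hom_ext_relCls fun Y _ y => ?_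
  have hP : IsPullback (pullback.fst y η[G]) (toUnit _) y η[G] := by
    rw [toUnit_unique (toUnit _) (pullback.snd y η[G])]
    exact IsPullback.of_hasPullback y η[G]
  have hp : pullback.fst y η[G] ≫ y = 1 := hP.w
  -- This makes the inclusion of the fibre mono, as `isPullback_one` requires after multiplying by
  -- `G`.
  have : Mono η[G] := ⟨fun a b _ => toUnit_unique a b⟩
  refine (congrArg (zDiscDagger G) (conjugation_relCls y)).trans ?_
  refine (zDiscDagger_relCls (p := pullback.fst y η[G] ▷ G) ?_).trans ?_
  · have : Mono (pullback.fst y η[G] ▷ G) := ⟨fun a b hab => by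
      have h1 := hab =≫ fst _ _
      have h2 := hab =≫ snd _ _
      simp only [Category.assoc, whiskerRight_fst, whiskerRight_snd] at h1 h2
      ext : 1
      · rw [← cancel_mono (pullback.fst y η[G])]
        simpa using h1
      · exact h2⟩
    refine isPullback_one ?_ fun T t ht => ?_
    · simp [MonObj.comp_mul, GrpObj.comp_inv, hp, MonObj.comp_one]
    · simp only [MonObj.comp_mul, GrpObj.comp_inv] at ht
      rw [conj_eq_one_iff] at ht
      refine ⟨lift (hP.lift (t ≫ fst _ _) (toUnit T) (by simpa [toUnit_comp_one] using ht))
        (t ≫ snd _ _), ?_⟩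
      ext <;> simp
  · rw [virtualClass_tensor, mul_comm, ← zDiscDagger_relCls hP]
    rfl

end Operators

/-! ### Iterated convolutions -/

section Iterate

lemma prod_map_mul_left_of_commute {M : Type*} [Monoid M] (a : M) (l : List M)
    (h : ∀ x ∈ l, Commute a x) : (l.map (a * ·)).prod = a ^ l.length * l.prod := by
  induction l with
  | nil => simp
  | cons x l ih =>
    rw [List.map_cons, List.prod_cons, List.prod_cons, ih fun y hy => h y (by simp [hy]),
      List.length_cons, pow_succ', _root_.mul_assoc, _root_.mul_assoc, ← _root_.mul_assoc x,
      ← ((h x (by simp)).pow_left l.length).eq, _root_.mul_assoc]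

variable {S : Scheme.{u}}

lemma comp_list_prod {G : Over S} [GrpObj G] {T T' : Over S} (φ : T ⟶ T') (l : List (T' ⟶ G)) :
    φ ≫ l.prod = (l.map fun x => φ ≫ x).prod :=
  map_list_prod (MonoidHom.mk' (fun x : T' ⟶ G => φ ≫ x) fun a b => MonObj.comp_mul φ a b) l

/-- The reversal makes `c 0` act first, so the factors appear to the right of `y` in increasing
order. The induction generalises `Y` in order to absorb `D 0` into it. -/
lemma convolution_list_relCls {G : Over S} [GrpObj G] [IsVar G] {n : ℕ} (D : Fin n → Over S)
    [∀ i, IsVar (D i)] (c : ∀ i, D i ⟶ G) {Y : Over S} [IsVar Y] (y : Y ⟶ G) :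
    (List.ofFn fun i => convolution (c i)).reverse.prod (relCls y) =
      relCls (fst Y (∏ᶜ D) ≫ y *
        (List.ofFn fun i => snd Y (∏ᶜ D) ≫ Pi.π D i ≫ c i).prod) := by
  induction n generalizing Y with
  | zero =>
    have hu (T : Over S) (a b : T ⟶ ∏ᶜ D) : a = b := Limits.Pi.hom_ext _ _ fun i => i.elim0
    refine relCls_eq_of_iso (f := y) ⟨lift (𝟙 Y) (Pi.lift fun i => i.elim0), fst _ _, ?_, ?_⟩ ?_
    · simp
    · ext : 1
      · simp
      · exact hu _ _ _
    · simp
  | succ n ih =>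
    rw [List.ofFn_succ, List.reverse_cons, List.prod_append, List.prod_singleton,
      AddMonoid.End.coe_mul, Function.comp_apply, convolution_relCls,
      ih (fun i => D i.succ) fun i => c i.succ]
    let f : (Y ⊗ D 0) ⊗ (∏ᶜ fun i : Fin n => D i.succ) ⟶ ∏ᶜ D :=
      Pi.lift (Fin.cases (fst _ _ ≫ snd _ _) fun i => snd _ _ ≫ Pi.π (fun i => D (Fin.succ i)) i)
    have hf0 : f ≫ Pi.π D 0 = fst _ _ ≫ snd _ _ := by simp [f]
    have hf (i : Fin n) : f ≫ Pi.π D i.succ = snd _ _ ≫ Pi.π (fun i => D (Fin.succ i)) i := by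
      simp [f]
    let e : (Y ⊗ D 0) ⊗ (∏ᶜ fun i : Fin n => D i.succ) ⟶ Y ⊗ ∏ᶜ D := lift (fst _ _ ≫ fst _ _) f
    refine relCls_eq_of_iso ⟨e,
      lift (lift (fst _ _) (snd _ _ ≫ Pi.π D 0)) (snd _ _ ≫ Pi.lift fun i => Pi.π D i.succ),
      ?_, ?_⟩ ?_ <;> dsimp only [e]
    · ext : 1
      · ext : 1
        · simp
        · simp [hf0]
      · refine Limits.Pi.hom_ext _ _ fun i => ?_
        simp [hf]
    · ext : 1
      · simp
      · refine Limits.Pi.hom_ext _ _ fun i => ?_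
        refine Fin.cases ?_ (fun i => ?_) i
        · simp [hf0]
        · simp [hf]
    · rw [List.ofFn_succ, List.prod_cons, MonObj.comp_mul, MonObj.comp_mul, lift_fst_assoc,
        lift_snd_assoc, reassoc_of% hf0, MonObj.comp_mul, _root_.mul_assoc]
      simp only [Category.assoc]
      congr 2
      rw [comp_list_prod, List.map_ofFn]
      congr 2
      ext1 i
      simp [← Category.assoc f, hf]

end Iterate

/-! ### The representation variety as a fibre of an iterated product -/

section RepVariety

variable {S : Scheme.{u}} (G : Over S) [GrpObj G] (g s : ℕ) (Q : Fin s → ConjSubvariety G)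
  (ε : Fin s → ℤˣ)

/-- The product of the commutators and of the parabolic elements, on the product of the unit, of
`g` copies of `G²` and of the subvarieties `Q j`. -/
def surfaceMap :
    (𝟙_ (Over S) ⊗ ∏ᶜ fun _ : Fin g => G ⊗ G) ⊗ (∏ᶜ fun j => (Q j).obj) ⟶ G :=
  fst _ _ ≫ (fst _ _ ≫ η[G] *
      (List.ofFn fun i => snd _ _ ≫ Pi.π (fun _ : Fin g => G ⊗ G) i ≫ commutatorMap G).prod) *
    (List.ofFn fun j => snd _ _ ≫ Pi.π (fun j => (Q j).obj) j ≫ (Q j).incl ^ (ε j : ℤ)).prod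

lemma comp_surfaceMap {T : Over S}
    (t : T ⟶ (𝟙_ (Over S) ⊗ ∏ᶜ fun _ : Fin g => G ⊗ G) ⊗ (∏ᶜ fun j => (Q j).obj))
    (A : SurfaceGen g s → (T ⟶ G))
    (ha : ∀ i, A (.a i) = t ≫ fst _ _ ≫ snd _ _ ≫ Pi.π _ i ≫ fst _ _)
    (hb : ∀ i, A (.b i) = t ≫ fst _ _ ≫ snd _ _ ≫ Pi.π _ i ≫ snd _ _)
    (hc : ∀ j, A (.c j) = (t ≫ snd _ _ ≫ Pi.π _ j ≫ (Q j).incl) ^ (ε j : ℤ)) :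
    t ≫ surfaceMap G g s Q ε = FreeGroup.lift A (surfaceRelator g s) := by
  -- The coordinate in the terminal object contributes the factor 1.
  have h1 := congrArg (· ≫ η[G]) (toUnit_unique (t ≫ fst _ _ ≫ fst _ _) (toUnit T))
  simp only [Category.assoc, toUnit_comp_one] at h1
  simp only [surfaceMap, surfaceRelator, MonObj.comp_mul, comp_list_prod, List.map_ofFn, map_mul,
    map_list_prod, h1, _root_.one_mul, Function.comp_def, map_inv, FreeGroup.lift_apply_of, ha, hb,
    hc, GrpObj.comp_inv, GrpObj.comp_zpow]

/-- As e² = 1, the conditions C^e = ξ and C = ξ^e are interchangeable. -/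
lemma zpow_zpow_units {M : Type*} [Group M] (x : M) (e : ℤˣ) : (x ^ (e : ℤ)) ^ (e : ℤ) = x := by
  rw [← zpow_mul, ← Units.val_mul, Int.units_mul_self, Units.val_one, zpow_one]

/-- The map from the representation variety to the product of the unit, of `g` copies of `G²` and
of the subvarieties `Q j`. -/
def SurfaceRepVariety.toProduct :
    RepVariety G (fun _ : Unit => surfaceRelator g s) (meridian ε) Q ⟶
    (𝟙_ (Over S) ⊗ ∏ᶜ fun _ : Fin g => G ⊗ G) ⊗ (∏ᶜ fun j => (Q j).obj) :=
  let p := pullback.fst (wordMap G (fun _ : Unit => surfaceRelator g s) (meridian ε))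
    (dataMap G Unit Q)
  lift (lift (toUnit _) (Pi.lift fun i => lift (p ≫ Pi.π (fun _ => G) (.a i))
    (p ≫ Pi.π (fun _ => G) (.b i)))) (pullback.snd _ _)

/-- The point ξ_j of `Q j` determines C_j = ξ_j^{ε_j}, so forgetting the C_j loses nothing;
conversely a point of the product on which the relator is trivial gives a representation. -/
lemma SurfaceRepVariety.isPullback :
    IsPullback (toProduct G g s Q ε) (toUnit _) (surfaceMap G g s Q ε) η[G] := by
  let p := pullback.fst (wordMap G (fun _ : Unit => surfaceRelator g s) (meridian ε))
    (dataMap G Unit Q)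
  let q := pullback.snd (wordMap G (fun _ : Unit => surfaceRelator g s) (meridian ε))
    (dataMap G Unit Q)
  let A (i : SurfaceGen g s) :
      RepVariety G (fun _ : Unit => surfaceRelator g s) (meridian ε) Q ⟶ G := p ≫ Pi.π (fun _ => G) i
  have h := (comp_wordMap_eq_iff G (fun _ : Unit => surfaceRelator g s) (meridian ε) Q p q).1
    pullback.condition
  have hA (j) : A (.c j) = (q ≫ Pi.π _ j ≫ (Q j).incl) ^ (ε j : ℤ) := by
    have := h.2 j
    rw [meridian, map_zpow, FreeGroup.lift_apply_of] at this
    rw [← Category.assoc, ← this, zpow_zpow_units]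
  have : Mono (toProduct G g s Q ε) := ⟨fun {T} u v huv => by
    have hq : u ≫ q = v ≫ q := by simpa [toProduct] using huv =≫ snd _ _
    have hp : u ≫ p = v ≫ p := by
      refine Limits.Pi.hom_ext _ _ fun i => ?_
      rw [Category.assoc, Category.assoc]
      change u ≫ A i = v ≫ A i
      cases i with
      | a i => simpa [toProduct] using huv =≫ fst _ _ ≫ snd _ _ ≫ Pi.π _ i ≫ fst _ _
      | b i => simpa [toProduct] using huv =≫ fst _ _ ≫ snd _ _ ≫ Pi.π _ i ≫ snd _ _
      | c j => rw [hA, GrpObj.comp_zpow, GrpObj.comp_zpow, ← Category.assoc, hq, Category.assoc]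
    exact pullback.hom_ext hp hq⟩
  refine isPullback_one ?_ fun T t ht => ?_
  · rw [comp_surfaceMap G g s Q ε _ A _ _ _]
    · exact h.1 ()
    · intro i; simp [A, toProduct, p]
    · intro i; simp [A, toProduct, p]
    · intro j; simp [hA, toProduct, q]
  -- The representation rebuilt from `t`; the parabolic conditions hold because raising to ε_j twice
  -- returns ξ_j.
  · let B : SurfaceGen g s → (T ⟶ G)
      | .a i => t ≫ fst _ _ ≫ snd _ _ ≫ Pi.π _ i ≫ fst _ _
      | .b i => t ≫ fst _ _ ≫ snd _ _ ≫ Pi.π _ i ≫ snd _ _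
      | .c j => (t ≫ snd _ _ ≫ Pi.π _ j ≫ (Q j).incl) ^ (ε j : ℤ)
    have hB : (fun i => Pi.lift B ≫ Pi.π (fun _ : SurfaceGen g s => G) i) = B := by
      ext1 i; simp
    have hw : Pi.lift B ≫ wordMap G (fun _ : Unit => surfaceRelator g s) (meridian ε) =
        (t ≫ snd _ _) ≫ dataMap G Unit Q := by
      rw [comp_wordMap_eq_iff, hB]
      refine ⟨fun _ => ?_, fun j => ?_⟩
      · rw [← comp_surfaceMap G g s Q ε t B (fun _ => rfl) (fun _ => rfl) (fun _ => rfl), ht]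
      · rw [meridian, map_zpow, FreeGroup.lift_apply_of]
        simp only [B, zpow_zpow_units, Category.assoc]
    obtain ⟨r, hp, hq⟩ : ∃ r : T ⟶ RepVariety G (fun _ : Unit => surfaceRelator g s) (meridian ε) Q,
        r ≫ p = Pi.lift B ∧ r ≫ q = t ≫ snd _ _ :=
      ⟨pullback.lift _ _ hw, pullback.lift_fst _ _ hw, pullback.lift_snd _ _ hw⟩
    have hr (i) : r ≫ p ≫ Pi.π (fun _ => G) i = B i := by
      rw [← Category.assoc, hp, Pi.lift_π]
    refine ⟨r, ?_⟩
    ext : 1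
    · ext : 1
      · exact toUnit_unique _ _
      · refine Limits.Pi.hom_ext _ _ fun i => ?_
        ext : 1
        · simpa [toProduct] using hr (.a i)
        · simpa [toProduct] using hr (.b i)
    · simpa [toProduct] using hq

end RepVariety

/-! ### The main theorem -/

lemma zSurface_one {k : Type u} [Field k] [IsAlgClosed k] (G : Over (Spec (.of k))) [GrpObj G]
    [IsVar G] (g s : ℕ) (Q : Fin s → ConjSubvariety G) (ε : Fin s → ℤˣ) :
    zSurface G g s Q ε 1 =
      virtualClass G ^ (g + s) * virtualClass (SurfaceRepVariety G g s Q ε) := by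
  have h1 : (List.ofFn fun j => zTube G (Q j) (ε j)).reverse.prod = conjugation G ^ s *
      (List.ofFn fun j => convolution ((Q j).incl ^ (ε j : ℤ))).reverse.prod := by
    have := prod_map_mul_left_of_commute (conjugation G)
      (List.ofFn fun j => convolution ((Q j).incl ^ (ε j : ℤ))).reverse (by
        simp only [List.mem_reverse, List.mem_ofFn]
        rintro _ ⟨j, rfl⟩
        exact commute_conjugation_conjSubvariety (Q j) _)
    rw [List.length_reverse, List.length_ofFn, List.map_reverse, List.map_ofFn] at this
    rw [← this]
    simp only [zTube_eq, Function.comp_def]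
  have h2 : Commute (conjugation G)
      (List.ofFn fun j => convolution ((Q j).incl ^ (ε j : ℤ))).reverse.prod :=
    Commute.list_prod_right _ _ (by
      simp only [List.mem_reverse, List.mem_ofFn]
      rintro _ ⟨j, rfl⟩
      exact commute_conjugation_conjSubvariety (Q j) _)
  have h3 : (List.ofFn fun j => zTube G (Q j) (ε j)).reverse.prod * zHoledTorus G ^ g =
      conjugation G ^ (g + s) *
        ((List.ofFn fun j => convolution ((Q j).incl ^ (ε j : ℤ))).reverse.prod *
          (List.ofFn fun _ : Fin g => convolution (commutatorMap G)).reverse.prod) := by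
    -- The `g` equal commutator convolutions are stated as a reversed list, the form
    -- `convolution_list_relCls` takes; here that list is turned back into a power.
    rw [h1, zHoledTorus_eq, commute_conjugation_commutator.mul_pow, List.ofFn_const,
      List.reverse_replicate, List.prod_replicate, add_comm, pow_add]
    simp only [_root_.mul_assoc]
    rw [← _root_.mul_assoc _ (conjugation G ^ g), ← (h2.pow_left g).eq]
    simp only [_root_.mul_assoc]
  have h4 (n : ℕ) (x : K0 G.left) :
      zDiscDagger G ((conjugation G ^ n) x) = virtualClass G ^ n * zDiscDagger G x := by
    induction n with
    | zero => simp
    | succ n ih =>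
      rw [pow_succ', AddMonoid.End.coe_mul, Function.comp_apply, zDiscDagger_conjugation, ih,
        pow_succ', _root_.mul_assoc]
  change zDiscDagger G (((List.ofFn fun j => zTube G (Q j) (ε j)).reverse.prod *
    zHoledTorus G ^ g) (zDisc G 1)) = _
  -- Starting from the unit of `G`, the list formula is used for the commutators and then for the `Q
  -- j`; the resulting family is `surfaceMap` by definition.
  rw [h3, AddMonoid.End.coe_mul, Function.comp_apply, h4, zDisc_one, AddMonoid.End.coe_mul,
    Function.comp_apply, convolution_list_relCls, convolution_list_relCls]
  exact congrArg _ (zDiscDagger_relCls (SurfaceRepVariety.isPullback G g s Q ε))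

end RepTQFT

end

theorem mainTheorem6 {k : Type u} [Field k] [IsAlgClosed k] (G : Over (Spec (.of k))) [GrpObj G]
    [RepTQFT.IsVar G] [IsReduced G.left] (g s : ℕ) (Q : Fin s → RepTQFT.ConjSubvariety G)
    (ε : Fin s → ℤˣ) :
    RepTQFT.virtualClass G ^ (g + s) *
          RepTQFT.virtualClass (RepTQFT.SurfaceRepVariety G g s Q ε) =
        RepTQFT.zSurface G g s Q ε 1 ∧
      algebraMap (RepTQFT.K0 (Spec (.of k))) (Localization.Away (RepTQFT.virtualClass G))
          (RepTQFT.virtualClass (RepTQFT.SurfaceRepVariety G g s Q ε)) =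
        IsLocalization.Away.invSelf (RepTQFT.virtualClass G) ^ (g + s) *
          algebraMap (RepTQFT.K0 (Spec (.of k))) (Localization.Away (RepTQFT.virtualClass G))
            (RepTQFT.zSurface G g s Q ε 1) := by
  refine ⟨(RepTQFT.zSurface_one G g s Q ε).symm, ?_⟩
  rw [RepTQFT.zSurface_one, map_mul, map_pow, ← _root_.mul_assoc, ← mul_pow, mul_comm
    (IsLocalization.Away.invSelf (RepTQFT.virtualClass G)), IsLocalization.Away.mul_invSelf,
    one_pow, _root_.one_mul]
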